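/- Throughout, $\varsigma=e^{i\pi/4}$, and all edge lengths are of order $1$. **Domain.** Let $\Omega$ be a finite discrete simply connected domain made of quads of a planar graph $\Lambda(G)=G^\bullet\cup G^\circ$ (quads $z=(v_0^\bullet v_0^\circ v_1^\bullet v_1^\circ)$ correspond to edges of $G^\bullet$; edges $c=(v^\bullet v^\circ)$ of $\Lambda(G)$ are called corners). Its boundary consists of a wired arc through white vertices $v^\circ_0,\dots,v^\circ_n$ with boundary half-quads $z_k=(v^\circ_k v^\bullet_k v^\circ_{k+1})$, of a free arc through black vertices, also made of half-quads, and of two corners at which the arcs meet. Let $\beta J_z>0$ be Ising couplings, $\theta_z=2\arctan e^{-2\beta J_z}$, and let $\mathcal S:\Lambda(G)\to\mathbb C$ be a proper non-degenerate s-embedding: $\mathcal S(v^\bullet(c))-\mathcal S(v^\circ(c))=\mathcal X(c)^2$ for a complex spinor $\mathcal X$ satisfying the three-term relations $\mathcal X(c_{pq})=\mathcal X(c_{p,1-q})\cos\theta_z+\mathcal X(c_{1-p,q})\sin\theta_z$ at neighbouring lifts of the corners $c_{pq}=(v^\bullet_pv^\circ_q)$ of each quad to the double cover of the set of corners branching around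 every $v^\bullet$, $v^\circ$ and $z$. Half-quads are halves of quads of the ambient s-embedding. The origami function $\mathcal Q$ is defined, up to a constant, by $\mathcal Q(v^\bullet)-\mathcal Q(v^\circ)=|\mathcal S(v^\bullet)-\mathcal S(v^\circ)|$ at every corner. **Observable.** For the Ising model on $G^\circ\cap\Omega$, with spins wired along the wired arc and free along the free arc, let $X(c)=\mathbb E[\mu_{v^\bullet(c)}\sigma_{v^\circ(c)}\,\sigma_{\rm wired}\,\mu_{\rm free}]$ be the Kadanoff–Ceva FK observable (with $\mu_{v^\bullet(c)}\mu_{\rm free}=\prod_{e\in\gamma}e^{-2\beta J_e\sigma_{v_0^\circ(e)}\sigma_{v_1^\circ(e)}}$ for a disorder line $\gamma\subset G^\bullet$ from $v^\bullet(c)$ to the free arc; $X$ is a spinor, i.e. it is defined up to sign, $|X(c)|$ being well defined). Let $F$ be the associated s-holomorphic function on quads and half-quads: $X(c)=\mathrm{Re}[\overline\varsigma\,\mathcal X(c)F(z)]$ for each corner $c$ of $z$, and for any two faces $z,z'$ sharing a corner $c$ the projections of $F(z)$ and $F(z')$ onto the line $\eta_c\mathbb R$, $\eta_c=\varsigma\exp[-\tfrac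 i2\arg(\mathcal S(v^\bullet(c))-\mathcal S(v^\circ(c)))]$, coincide. $F$ is defined up to a global sign. **Horizontal layer.** Suppose that $z_k$, $k_0\le k<k_1$, form a horizontal boundary layer of halves of kites at the bottom of the domain: $\mathcal S(v^\circ_{k+1})-\mathcal S(v^\circ_k)>0$ is real, $\mathcal S(v_k^\bullet)$ lies strictly above this line, the fourth vertex of the kite lies strictly below it, and the quads of the domain touching $v^\circ_k$ for $k_0<k<k_1$ lie above the line, with black vertices strictly above it. Suppose also that the layer satisfies $\mathrm{Unif}(1,r_0,\theta_0)$ with $r_0\ge1$, $\theta_0>0$: $r_0^{-1}\le|\mathcal S(v_k^\bullet)-\mathcal S(v^\circ)|\le r_0$ for $v^\circ\in\{v^\circ_k,v^\circ_{k+1}\}$, and angles are at least $\theta_0$ (only the angle of $z_k$ at $v_k^\bullet$ matters). **Claim.** There exist $\phi_0>0$ and $C>0$, depending only on $r_0$ and $\theta_0$, such that, in every such situation and for a suitable choice of the global sign of $F$, for all $k_0\le k<k_1$ and all real $\phi$ with $|\phi|\le\frac\pi4+\phi_0$, $$\mathrm{Re}[F(z_k)e^{i\phi}]\ge0\qquad\text{and}\qquad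 C^{-1}|X(c_k^\pm)|\le\mathrm{Re}\Big[e^{i\phi}\big(F(z_k)\,d\mathcal S+i\,\overline{F(z_k)}\,d\mathcal Q\big)\Big]\le C\,|X(c_k^\pm)|,$$ where $c_k^-=(v_k^\bullet v_k^\circ)$, $c_k^+=(v_k^\bullet v_{k+1}^\circ)$, $d\mathcal S=\mathcal S(v^\circ_{k+1})-\mathcal S(v^\circ_k)$ and $d\mathcal Q=\mathcal Q(v^\circ_{k+1})-\mathcal Q(v^\circ_k)$. -/

import Mathlib

open Complex

/-- Combinatorial data of a discrete domain with Dobrushin boundary conditions.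
`B` is the set of vertices of `G•`, `W` the set of vertices of `G∘` and `Q` the set of (full) quads
of the domain. A quad `z` has black vertices `b z 0`, `b z 1` and white vertices `w z 0`, `w z 1`,
in the cyclic order `b z 0, w z 0, b z 1, w z 1`; it stands for the edge of `G•` joining its black
vertices and for the dual edge joining its white vertices.

Along the wired arc the boundary visits the white vertices `wired 0, …, wired n`, and
`(wired k, apex k, wired (k+1))` is the `k`-th boundary half-quad. Along the free arc the boundary
visits the black vertices `free 0, …, free m`, with boundary half-quads
`(free j, freeApex j, free (j+1))`. The boundary is completed by the two marked corners
`(free 0, wired n)` and `(free m, wired 0)`.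

`K z = β J_z` is the Ising coupling constant carried by the quad `z`. -/
structure DomainData (B W Q : Type) (n m : ℕ) where
  b : Q → Fin 2 → B
  w : Q → Fin 2 → W
  wired : Fin (n + 1) → W
  apex : Fin n → B
  free : Fin (m + 1) → B
  freeApex : Fin m → W
  K : Q → ℝ

/-- The faces of the domain: quads, half-quads of the wired arc, half-quads of the free arc. -/
abbrev Face (Q : Type) (n m : ℕ) : Type := Q ⊕ (Fin n ⊕ Fin m)

/-- The `k`-th boundary half-quad of the wired arc. -/
abbrev wiredFace {Q : Type} {n m : ℕ} (k : Fin n) : Face Q n m := Sum.inr (Sum.inl k)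

/-- The `j`-th boundary half-quad of the free arc. -/
abbrev freeFace {Q : Type} {n m : ℕ} (j : Fin m) : Face Q n m := Sum.inr (Sum.inr j)

/-- Data of an s-embedding of a domain: the positions `S` of the vertices of `Λ(G)`; for each face, the
angle `θ` and the values `X p q` of the spinor `𝒳` at (lifts of) the corners of the quad it is
or belongs to. A boundary half-quad is a half of a quad of the ambient s-embedding: the vertex of
this quad that is not in the domain (a black one along the wired arc, a white one along the free
arc) has position `missing`. -/
structure EmbeddingData (B W Q : Type) (n m : ℕ) where
  S : B ⊕ W → ℂ
  missing : Fin n ⊕ Fin m → ℂ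
  θ : Face Q n m → ℝ
  X : Face Q n m → Fin 2 → Fin 2 → ℂ

namespace EmbeddingData

variable {B W Q : Type} {n m : ℕ}

/-- The position of a black vertex. -/
abbrev black (E : EmbeddingData B W Q n m) (v : B) : ℂ := E.S (Sum.inl v)

/-- The position of a white vertex. -/
abbrev white (E : EmbeddingData B W Q n m) (y : W) : ℂ := E.S (Sum.inr y)

end EmbeddingData

namespace DomainData

variable {B W Q : Type} {n m : ℕ}

/-- `D.HasCorner f v y`: the edge `(v y)` of `Λ(G)`, with `v` black and `y` white, is a side of the
face `f`. -/
def HasCorner (D : DomainData B W Q n m) : Face Q n m → B → W → Prop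
  | Sum.inl z, v, y => (∃ p, D.b z p = v) ∧ (∃ q, D.w z q = y)
  | Sum.inr (Sum.inl k), v, y =>
      D.apex k = v ∧ (D.wired k.castSucc = y ∨ D.wired k.succ = y)
  | Sum.inr (Sum.inr j), v, y =>
      (D.free j.castSucc = v ∨ D.free j.succ = v) ∧ D.freeApex j = y

/-- The two corners at which the wired arc and the free arc meet. -/
def IsMarkedCorner (D : DomainData B W Q n m) (v : B) (y : W) : Prop :=
  (v = D.free 0 ∧ y = D.wired (Fin.last n)) ∨ (v = D.free (Fin.last m) ∧ y = D.wired 0)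

/-- The graph `G•`, with any two vertices of the free arc joined to each other. -/
def blackGraph (D : DomainData B W Q n m) : SimpleGraph B :=
  SimpleGraph.fromRel fun v v' =>
    (∃ z, D.b z 0 = v ∧ D.b z 1 = v') ∨ (v ∈ Set.range D.free ∧ v' ∈ Set.range D.free)

/-- The faces fit together to a discrete simply connected domain (a connected surface with one
boundary curve and Euler characteristic `1`), whose boundary is made of a wired and a free arc;
the model on it is ferromagnetic. -/
structure IsDobrushinDomain [Fintype B] [Fintype W] [Fintype Q] (D : DomainData B W Q n m) :
    Prop where
  K_pos : ∀ z, 0 < D.K z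
  b_ne : ∀ z, D.b z 0 ≠ D.b z 1
  w_ne : ∀ z, D.w z 0 ≠ D.w z 1
  wired_injective : Function.Injective D.wired
  free_injective : Function.Injective D.free
  /-- every corner is a side of exactly two faces, except the two marked boundary corners -/
  glue : ∀ f v y, D.HasCorner f v y → ¬ D.IsMarkedCorner v y →
    {g | D.HasCorner g v y}.ncard = 2
  glue_marked : ∀ v y, D.IsMarkedCorner v y → {g | D.HasCorner g v y}.ncard = 1
  /-- the faces around a vertex form a single fan -/
  white_fan : ∀ y f g, (∃ v, D.HasCorner f v y) → (∃ v, D.HasCorner g v y) →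
    Relation.ReflTransGen (fun f g => ∃ v, D.HasCorner f v y ∧ D.HasCorner g v y) f g
  black_fan : ∀ v f g, (∃ y, D.HasCorner f v y) → (∃ y, D.HasCorner g v y) →
    Relation.ReflTransGen (fun f g => ∃ y, D.HasCorner f v y ∧ D.HasCorner g v y) f g
  white_mem : ∀ y, ∃ f v, D.HasCorner f v y
  connected : D.blackGraph.Connected
  euler : Fintype.card B + Fintype.card W = Fintype.card Q + n + m + 2

noncomputable section

/-! ### The Ising model and its Kadanoff–Ceva fermion -/

/-- The abstract angle `θ_z = 2 arctan x`, with `x = exp(-2βJ)`. -/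
def theta (D : DomainData B W Q n m) (z : Q) : ℝ := 2 * Real.arctan (Real.exp (-2 * D.K z))

/-- A spin in `{±1}` as a real number. -/
def spin (σ : W → ℤˣ) (y : W) : ℝ := ((σ y : ℤ) : ℝ)

open Classical in
/-- Spin configurations on `G∘` with wired boundary conditions on the wired arc; there is no
constraint on the free arc. -/
def configs [Fintype W] (D : DomainData B W Q n m) : Finset (W → ℤˣ) :=
  Finset.univ.filter fun σ => ∀ i, σ (D.wired i) = σ (D.wired 0)

/-- The product of the two spins separated by the edge `z`. -/
def bond (D : DomainData B W Q n m) (z : Q) (σ : W → ℤˣ) : ℝ :=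
  spin σ (D.w z 0) * spin σ (D.w z 1)

/-- The Boltzmann weight of a spin configuration. -/
def weight [Fintype Q] (D : DomainData B W Q n m) (σ : W → ℤˣ) : ℝ :=
  Real.exp (∑ z, D.K z * D.bond z σ)

/-- Expectation in the Ising model with Dobrushin boundary conditions. -/
def expect [Fintype W] [Fintype Q] (D : DomainData B W Q n m) (f : (W → ℤˣ) → ℝ) : ℝ :=
  (∑ σ ∈ D.configs, D.weight σ * f σ) / ∑ σ ∈ D.configs, D.weight σ

/-- `γ` is a disorder line linking the black vertex `v` to the free arc, the free arc being
considered as a single vertex of `G•`. -/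
def IsDisorderLine (D : DomainData B W Q n m) (v : B) (γ : Finset Q) : Prop :=
  ∀ v' : B, v' ∉ Set.range D.free →
    (Odd {z | z ∈ γ ∧ ∃ p, D.b z p = v'}.ncard ↔ v' = v)

/-- The FK observable `X(c) = 𝔼[μ_{v•(c)} σ_{v∘(c)} σ_{wired arc} μ_{free arc}]` at a corner `c`
with white vertex `y`; the disorder `μ_{v•(c)} μ_{free arc}` is realised by the disorder line `γ`
from `v•(c)` to the free arc. Changing `γ` may change the sign: `γ` selects one of the two
lifts of `c` to the double cover. -/
def fkObservable [Fintype W] [Fintype Q] (D : DomainData B W Q n m) (y : W) (γ : Finset Q) : ℝ :=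
  D.expect fun σ =>
    spin σ y * spin σ (D.wired 0) * ∏ z ∈ γ, Real.exp (-2 * D.K z * D.bond z σ)

/-- The values of the FK observable at the four corners `c_{pq} = (b z p, w z q)` of a quad `z`, the
lift of `c_{00}` being given by a disorder line `γ` from `b z 0`. Neighbouring lifts are obtained
by moving the disorder along the edge `z` (`γ` becomes `γ ∆ {z}`) or by moving the spin across this
edge (a change of sign if the disorder line contains `z`), in the order
`c_{01}, c_{00}, c_{10}, c_{11}`. -/
def quadValue [Fintype W] [Fintype Q] [DecidableEq Q] (D : DomainData B W Q n m) (z : Q)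
    (γ : Finset Q) : Fin 2 → Fin 2 → ℝ :=
  let s : ℝ := if z ∈ γ then -1 else 1
  ![![D.fkObservable (D.w z 0) γ, s * D.fkObservable (D.w z 1) γ],
    ![D.fkObservable (D.w z 0) (symmDiff γ {z}),
      -s * D.fkObservable (D.w z 1) (symmDiff γ {z})]]

/-! ### s-embeddings -/

/-- The three-term relations around a quad with abstract angle `θ`, for lifts of its corners taken
in the order `c_{01}, c_{00}, c_{10}, c_{11}`. The double cover branches over the quad, so the
lift `c_{01}` is a neighbour of the other lift of `c_{11}`; hence the two minus signs. -/
def ThreeTerm (θ : ℝ) (X : Fin 2 → Fin 2 → ℂ) : Prop :=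
  X 0 0 = X 0 1 * Real.cos θ + X 1 0 * Real.sin θ ∧
  X 1 0 = X 1 1 * Real.cos θ + X 0 0 * Real.sin θ ∧
  X 0 1 = X 0 0 * Real.cos θ - X 1 1 * Real.sin θ ∧
  X 1 1 = X 1 0 * Real.cos θ - X 0 1 * Real.sin θ

/-- The positions of the two black vertices of the quad that a face is or belongs to. -/
def bpos (D : DomainData B W Q n m) (E : EmbeddingData B W Q n m) : Face Q n m → Fin 2 → ℂ
  | Sum.inl z => fun p => E.black (D.b z p)
  | Sum.inr (Sum.inl k) => ![E.black (D.apex k), E.missing (Sum.inl k)]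
  | Sum.inr (Sum.inr j) => ![E.black (D.free j.castSucc), E.black (D.free j.succ)]

/-- The positions of the two white vertices of the quad that a face is or belongs to. -/
def wpos (D : DomainData B W Q n m) (E : EmbeddingData B W Q n m) : Face Q n m → Fin 2 → ℂ
  | Sum.inl z => fun q => E.white (D.w z q)
  | Sum.inr (Sum.inl k) => ![E.white (D.wired k.castSucc), E.white (D.wired k.succ)]
  | Sum.inr (Sum.inr j) => ![E.white (D.freeApex j), E.missing (Sum.inr j)]

/-- The centre of the circle inscribed in the quad that a face is or belongs to. -/
def center (D : DomainData B W Q n m) (E : EmbeddingData B W Q n m) (f : Face Q n m) : ℂ :=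
  D.bpos E f 0 - E.X f 0 0 * E.X f 0 1 * Real.cos (E.θ f)

/-- The triangle spanned by the centre of a quad and its side `c_{pq}`. -/
def sector (D : DomainData B W Q n m) (E : EmbeddingData B W Q n m) (f : Face Q n m)
    (p q : Fin 2) : Set ℂ :=
  convexHull ℝ {D.center E f, D.bpos E f p, D.wpos E f q}

/-- The closed polygon drawn by a face. A tangential quadrilateral, convex or not, is star-shaped
about the centre of its inscribed circle, hence it is the union of its four sectors; a half-quad
consists of the two sectors at the sides that belong to the domain. -/
def region (D : DomainData B W Q n m) (E : EmbeddingData B W Q n m) : Face Q n m → Set ℂ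
  | Sum.inl z => ⋃ p, ⋃ q, D.sector E (Sum.inl z) p q
  | Sum.inr (Sum.inl k) => ⋃ q, D.sector E (wiredFace k) 0 q
  | Sum.inr (Sum.inr j) => ⋃ p, D.sector E (freeFace j) p 0

/-- `E` is a proper non-degenerate s-embedding of the domain. -/
structure IsSEmbedding (D : DomainData B W Q n m) (E : EmbeddingData B W Q n m) : Prop where
  θ_quad : ∀ z, E.θ (Sum.inl z) = D.theta z
  θ_mem : ∀ f, E.θ f ∈ Set.Ioo 0 (Real.pi / 2)
  sq : ∀ f p q, D.bpos E f p - D.wpos E f q = E.X f p q ^ 2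
  threeTerm : ∀ f, ThreeTerm (E.θ f) (E.X f)
  nondegenerate : ∀ f, (interior (D.region E f)).Nonempty
  proper : ∀ f g, f ≠ g → Disjoint (interior (D.region E f)) (interior (D.region E g))

/-- `𝒬` is the origami function of the s-embedding. -/
def IsOrigami (D : DomainData B W Q n m) (E : EmbeddingData B W Q n m) (𝒬 : B ⊕ W → ℝ) : Prop :=
  ∀ f v y, D.HasCorner f v y → 𝒬 (Sum.inl v) - 𝒬 (Sum.inr y) = ‖E.black v - E.white y‖

/-! ### s-holomorphic functions -/

/-- `ς = exp(iπ/4)`. -/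
def varsigma : ℂ := Complex.exp (Real.pi / 4 * I)

/-- The Dirac spinor `η_c` of the corner `c = (v y)`, up to sign. -/
def eta (E : EmbeddingData B W Q n m) (v : B) (y : W) : ℂ :=
  varsigma * Complex.exp (-(I / 2) * (arg (E.black v - E.white y) : ℂ))

/-- `Proj[F(f); η_c ℝ] = Proj[F(g); η_c ℝ]` for any two faces sharing the corner `c`. -/
def IsSHolomorphic (D : DomainData B W Q n m) (E : EmbeddingData B W Q n m)
    (F : Face Q n m → ℂ) : Prop :=
  ∀ f g v y, D.HasCorner f v y → D.HasCorner g v y →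
    (Submodule.span ℝ {eta E v y}).starProjection (F f) =
      (Submodule.span ℝ {eta E v y}).starProjection (F g)

/-- The spinor `Re[ς̄ 𝒳(c_{pq}) F(f)]` defined by `F` at the corners of a face. -/
def spinorOf (E : EmbeddingData B W Q n m) (F : Face Q n m → ℂ) (f : Face Q n m)
    (p q : Fin 2) : ℝ :=
  (starRingEnd ℂ varsigma * E.X f p q * F f).re

/-- `F` is an s-holomorphic function associated with the FK observable `X` of the domain: on each
face, `X(c) = Re[ς̄ 𝒳(c) F]` at the corners `c` of the face, where `X` and `𝒳` are evaluated at
compatible lifts of these corners (there are two such choices, whence the sign `s`). In a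
half-quad, neighbouring lifts of its two corners are given by the same disorder line, as no edge
carrying an interaction is crossed. -/
structure IsFKFunction [Fintype W] [Fintype Q] [DecidableEq Q] (D : DomainData B W Q n m)
    (E : EmbeddingData B W Q n m) (F : Face Q n m → ℂ) : Prop where
  sHolomorphic : D.IsSHolomorphic E F
  quad : ∀ z γ, D.IsDisorderLine (D.b z 0) γ → ∃ s : ℝ, (s = 1 ∨ s = -1) ∧
    ∀ p q, D.quadValue z γ p q = s * spinorOf E F (Sum.inl z) p q
  wiredHalf : ∀ k γ, D.IsDisorderLine (D.apex k) γ → ∃ s : ℝ, (s = 1 ∨ s = -1) ∧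
    D.fkObservable (D.wired k.castSucc) γ = s * spinorOf E F (wiredFace k) 0 0 ∧
    D.fkObservable (D.wired k.succ) γ = s * spinorOf E F (wiredFace k) 0 1
  freeHalf : ∀ j γ, D.IsDisorderLine (D.free j.castSucc) γ → ∃ s : ℝ, (s = 1 ∨ s = -1) ∧
    D.fkObservable (D.freeApex j) γ = s * spinorOf E F (freeFace j) 0 0 ∧
    D.fkObservable (D.freeApex j) γ = s * spinorOf E F (freeFace j) 1 0

/-! ### Horizontal layers of kites -/

/-- The half-quads `k₀ ≤ k < k₁` of the wired arc form a horizontal layer at the bottom of the domain,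
traversed from left to right: their white vertices lie on a horizontal line, this line separates
the two black vertices of the quad to which a half-quad belongs (as it does for a kite with a
horizontal diagonal), and the other quads touching the layer between its two ends lie above the
line, with black vertices strictly above it. -/
structure IsHorizontalLayer (D : DomainData B W Q n m) (E : EmbeddingData B W Q n m)
    (k₀ k₁ : ℕ) : Prop where
  re_lt : ∀ k : Fin n, k₀ ≤ k → k < k₁ →
    (E.white (D.wired k.castSucc)).re < (E.white (D.wired k.succ)).re
  im_eq : ∀ k : Fin n, k₀ ≤ k → k < k₁ →
    (E.white (D.wired k.succ)).im = (E.white (D.wired k.castSucc)).im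
  im_apex : ∀ k : Fin n, k₀ ≤ k → k < k₁ →
    (E.white (D.wired k.castSucc)).im < (E.black (D.apex k)).im
  im_missing : ∀ k : Fin n, k₀ ≤ k → k < k₁ →
    (E.missing (Sum.inl k)).im < (E.white (D.wired k.castSucc)).im
  above : ∀ i : Fin (n + 1), k₀ < i → i < k₁ → ∀ f v, D.HasCorner f v (D.wired i) →
    (E.white (D.wired i)).im < (E.black v).im ∧
    ∀ q, (E.white (D.wired i)).im ≤ (D.wpos E f q).im

/-- The assumption `Unif(1, r₀, θ₀)` for the `k`-th half-quad of the wired arc: its sides have lengths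
in `[r₀⁻¹, r₀]` and its angle at the black vertex, which is also the angle there of the quad to
which it belongs, is at least `θ₀`. (The other lengths and angles of the quad are not used.) -/
structure UnifHalfQuad (D : DomainData B W Q n m) (E : EmbeddingData B W Q n m) (r₀ θ₀ : ℝ)
    (k : Fin n) : Prop where
  left_ge : r₀⁻¹ ≤ ‖E.black (D.apex k) - E.white (D.wired k.castSucc)‖
  left_le : ‖E.black (D.apex k) - E.white (D.wired k.castSucc)‖ ≤ r₀
  right_ge : r₀⁻¹ ≤ ‖E.black (D.apex k) - E.white (D.wired k.succ)‖
  right_le : ‖E.black (D.apex k) - E.white (D.wired k.succ)‖ ≤ r₀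
  angle_ge : θ₀ ≤ EuclideanGeometry.angle (E.white (D.wired k.castSucc))
    (E.black (D.apex k)) (E.white (D.wired k.succ))

/-- The boundary increment `F(z_k) dS + i conj(F(z_k)) d𝒬` along the `k`-th half-quad of the wired
arc, from `wired k` to `wired (k+1)`. -/
def increment (D : DomainData B W Q n m) (E : EmbeddingData B W Q n m) (𝒬 : B ⊕ W → ℝ)
    (F : Face Q n m → ℂ) (k : Fin n) : ℂ :=
  F (wiredFace k) * (E.white (D.wired k.succ) - E.white (D.wired k.castSucc)) +
    I * starRingEnd ℂ (F (wiredFace k)) *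
      ((𝒬 (Sum.inr (D.wired k.succ)) - 𝒬 (Sum.inr (D.wired k.castSucc)) : ℝ) : ℂ)

end

end DomainData

/-!
Let `p`, `q` be the square roots, in the first quadrant, of the vectors from the two white vertices
of a boundary half-quad to its apex, and `Φ` the value of `F` there. As the white spins agree along
the wired arc, `X` takes at both corners the same value `x > 0`, up to sign; once
`Re[ς̄pΦ] = Re[ς̄qΦ] = x`, the identity `Φp² + iΦ̄|p|² = 2Re[ς̄pΦ]ςp` shows that the increment is
`2xς(p - q)`, and `Φ` is a positive multiple of the conjugate of `ς(p - q)`. As `Im p² = Im q²`,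
the number `p - q` lies in the fourth quadrant, hence `ς(p - q)` in the cone `|Im| < Re`; the bounds
on the sides and on the angle keep it in a smaller closed cone, so that it can be rotated by
slightly more than `π/4`.

The signs agree along the layer because all the faces at an inner vertex of the layer lie above it:
the three-term relation then determines how the lifts of `𝒳` to the two corners of a quad at this
vertex are related to their first-quadrant values, and the same relation with the fourth vertex of
the kite below the line serves for the two corners of a half-quad. The observable being positive at
wired vertices, the sign of `Re[ς̄𝒳F]`, with `𝒳` in the first quadrant, does not change along the
fan of faces at a vertex and across a half-quad.
-/

theorem sin_le_cos_add {a b : ℝ} (ha : 0 ≤ a) (hb : 0 ≤ b) (hab : a ≤ Real.pi / 4 + b) :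
    Real.sin a ≤ Real.cos a + 2 * b := by
  have hπ := Real.pi_pos
  rcases le_total a (Real.pi / 4) with h | h
  · have hsin : Real.sin a ≤ Real.sin (Real.pi / 4) :=
      Real.sin_le_sin_of_le_of_le_pi_div_two (by linarith) (by linarith) h
    have hcos : Real.cos (Real.pi / 4) ≤ Real.cos a :=
      Real.cos_le_cos_of_nonneg_of_le_pi ha (by linarith) h
    rw [Real.sin_pi_div_four] at hsin
    rw [Real.cos_pi_div_four] at hcos
    linarith
  · have hsin := (abs_le.1 (Real.abs_sin_sub_sin_le a (Real.pi / 4))).2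
    have hcos := (abs_le.1 (Real.abs_cos_sub_cos_le a (Real.pi / 4))).1
    rw [abs_of_nonneg (sub_nonneg.2 h)] at hsin hcos
    rw [Real.sin_pi_div_four] at hsin
    rw [Real.cos_pi_div_four] at hcos
    linarith

theorem re_exp_mul_I_mul_ge {ε φ : ℝ} {w : ℂ} (hε : 0 ≤ ε) (hε₁ : ε ≤ 1) (hre : 0 ≤ w.re)
    (him : |w.im| ≤ (1 - ε) * w.re) (hφ : |φ| ≤ Real.pi / 4 + ε / 8) :
    ε / 4 * w.re ≤ (exp (φ * I) * w).re := by
  have hπ := Real.pi_gt_three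
  have hsin : |Real.sin φ| ≤ Real.cos φ + ε / 4 := by
    rw [Real.abs_sin_eq_sin_abs_of_abs_le_pi (by linarith), ← Real.cos_abs φ]
    linarith [sin_le_cos_add (abs_nonneg φ) (by positivity : 0 ≤ ε / 8) hφ]
  have hcos : 1 / 2 ≤ Real.cos φ := by
    rw [← Real.cos_abs, ← Real.cos_pi_div_three]
    exact Real.cos_le_cos_of_nonneg_of_le_pi (abs_nonneg φ) (by linarith) (by linarith)
  calc ε / 4 * w.re ≤ ((1 - ε) * (Real.cos φ - |Real.sin φ|) + ε * Real.cos φ) * w.re := by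
        refine mul_le_mul_of_nonneg_right ?_ hre
        nlinarith
    _ = Real.cos φ * w.re - |Real.sin φ| * ((1 - ε) * w.re) := by ring
    _ ≤ Real.cos φ * w.re - |Real.sin φ * w.im| := by
        rw [abs_mul]
        gcongr
    _ ≤ (exp (φ * I) * w).re := by
        rw [mul_re, exp_ofReal_mul_I_re, exp_ofReal_mul_I_im]
        linarith [le_abs_self (Real.sin φ * w.im)]

theorem two_mul_im_conj_mul_mul_re (p q : ℂ) :
    2 * (starRingEnd ℂ p * q).im * (starRingEnd ℂ p * q).re =
      (p ^ 2).re * (q ^ 2).im - (p ^ 2).im * (q ^ 2).re := by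
  simp only [sq, mul_im, mul_re, conj_re, conj_im]
  ring

theorem sin_half_angle_mul_norm {a b c p q : ℂ} (hp : p ^ 2 = c - a) (hq : q ^ 2 = c - b) :
    Real.sin (EuclideanGeometry.angle a c b / 2) * (‖p‖ * ‖q‖) = |(starRingEnd ℂ p * q).im| := by
  have hcos : Real.cos (EuclideanGeometry.angle a c b) * (‖p‖ ^ 2 * ‖q‖ ^ 2) =
      inner ℝ (p ^ 2) (q ^ 2) := by
    rw [EuclideanGeometry.angle, vsub_eq_sub, vsub_eq_sub, ← neg_sub c a, ← neg_sub c b, ← hp, ← hq,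
      InnerProductGeometry.angle_neg_neg, ← norm_pow, ← norm_pow,
      InnerProductGeometry.cos_angle_mul_norm_mul_norm]
  have hsin : 0 ≤ Real.sin (EuclideanGeometry.angle a c b / 2) :=
    Real.sin_nonneg_of_nonneg_of_le_pi (by linarith [EuclideanGeometry.angle_nonneg a c b])
      (by linarith [EuclideanGeometry.angle_le_pi a c b, Real.pi_pos])
  refine (sq_eq_sq₀ (by positivity) (abs_nonneg _)).1 ?_
  rw [sq_abs, mul_pow, mul_pow, Real.sin_sq_eq_half_sub, mul_div_cancel₀ _ two_ne_zero]
  have hprod : ‖p‖ ^ 2 * ‖q‖ ^ 2 =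
      (starRingEnd ℂ p * q).re ^ 2 + (starRingEnd ℂ p * q).im ^ 2 := by
    rw [← normSq_eq_norm_sq, ← normSq_eq_norm_sq, normSq_apply, normSq_apply]
    simp only [mul_im, mul_re, conj_re, conj_im]
    ring
  have hinner : inner ℝ (p ^ 2) (q ^ 2) =
      (starRingEnd ℂ p * q).re ^ 2 - (starRingEnd ℂ p * q).im ^ 2 := by
    simp only [Complex.inner, sq, mul_im, mul_re, conj_re, conj_im]
    ring
  linear_combination hprod / 2 - (hcos.trans hinner) / 2

theorem csqrt_sq (d : ℂ) : d.sqrt ^ 2 = d := by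
  simpa only [Complex.sqrt] using cpow_ofNat_inv_pow d 2

theorem norm_csqrt_sq (d : ℂ) : ‖d.sqrt‖ ^ 2 = ‖d‖ := by
  rw [← norm_pow, csqrt_sq]

theorem csqrt_re_pos {d : ℂ} (hd : 0 < d.im) : 0 < d.sqrt.re := by
  rw [Complex.sqrt, cpow_inv_two_re]
  have hre := neg_lt_of_abs_lt (abs_re_lt_norm.2 hd.ne')
  exact Real.sqrt_pos.2 (by linarith)

theorem csqrt_im_pos {d : ℂ} (hd : 0 < d.im) : 0 < d.sqrt.im := by
  rw [Complex.sqrt, cpow_inv_two_im_eq_sqrt hd.le]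
  have hre := lt_of_abs_lt (abs_re_lt_norm.2 hd.ne')
  exact Real.sqrt_pos.2 (by linarith)

theorem csqrt_eq_norm_mul_exp (d : ℂ) : d.sqrt = ‖d.sqrt‖ * exp (I / 2 * (arg d : ℂ)) := by
  rcases eq_or_ne d 0 with rfl | hd
  · simp [Complex.sqrt]
  have hexp : d.sqrt = Real.exp (Real.log ‖d‖ / 2) * exp (I / 2 * (arg d : ℂ)) := by
    rw [_root_.sqrt_eq_exp hd, ofReal_exp, ← exp_add, Complex.log]
    congr 1
    push_cast
    ring
  have hnorm : ‖exp (I / 2 * (arg d : ℂ))‖ = 1 := by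
    rw [norm_exp]
    simp
  rw [hexp, norm_mul, hnorm, mul_one, norm_real, Real.norm_of_nonneg (Real.exp_nonneg _)]

theorem im_mul_pos_of_im_sq_sub_le {t : ℝ} {X Y : ℂ} (ht : 0 < t) (hY : 0 < (Y ^ 2).im)
    (hle : ((X - t * Y) ^ 2).im ≤ (X ^ 2).im) : 0 < (X * Y).im := by
  have hexp : ((X - t * Y) ^ 2).im = (X ^ 2).im - 2 * t * (X * Y).im + t ^ 2 * (Y ^ 2).im := by
    simp only [sq, mul_im, mul_re, sub_im, sub_re, ofReal_re, ofReal_im]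
    ring
  have hmul : 0 < 2 * t * (X * Y).im := by
    have hpos : 0 < t ^ 2 * (Y ^ 2).im := by positivity
    linarith
  exact pos_of_mul_pos_right hmul (by positivity)

theorem exists_sign_mul_eq_abs {ι : Type*} {a : ι → ℝ} (h : ∀ i j, 0 < a i ↔ 0 < a j) :
    ∃ s : ℝ, (s = 1 ∨ s = -1) ∧ ∀ i, s * a i = |a i| := by
  by_cases hpos : ∃ i, 0 < a i
  · obtain ⟨i, hi⟩ := hpos
    exact ⟨1, Or.inl rfl, fun j => by rw [one_mul, abs_of_pos ((h i j).1 hi)]⟩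
  · push Not at hpos
    exact ⟨-1, Or.inr rfl, fun j => by rw [neg_one_mul, abs_of_nonpos (hpos j)]⟩

theorem odd_card_symmDiff_singleton {α : Type*} [DecidableEq α] (s : Finset α) (z : α) :
    Odd (symmDiff s {z}).card ↔ ¬ Odd s.card := by
  by_cases hz : z ∈ s
  · have herase : symmDiff s {z} = s.erase z := by grind [Finset.mem_symmDiff]
    rw [herase, ← Finset.card_erase_add_one hz, Nat.odd_add_one, not_not]
  · have hinsert : symmDiff s {z} = insert z s := by grind [Finset.mem_symmDiff]
    rw [hinsert, Finset.card_insert_of_notMem hz, Nat.odd_add_one]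

namespace DomainData

theorem varsigma_eq : varsigma = ((√2 / 2 : ℝ) : ℂ) * (1 + I) := by
  have h : (Real.pi / 4 * I : ℂ) = ((Real.pi / 4 : ℝ) : ℂ) * I := by push_cast; rfl
  rw [varsigma, h, exp_mul_I, ← ofReal_cos, ← ofReal_sin, Real.cos_pi_div_four,
    Real.sin_pi_div_four]
  ring

theorem norm_varsigma : ‖varsigma‖ = 1 := by
  rw [varsigma, norm_exp]
  simp

theorem conj_varsigma_mul_self : starRingEnd ℂ varsigma * varsigma = 1 := by
  rw [conj_mul', norm_varsigma, ofReal_one, one_pow]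

theorem varsigma_sq : varsigma ^ 2 = I := by
  rw [varsigma, ← exp_nat_mul, Nat.cast_ofNat,
    show 2 * (Real.pi / 4 * I) = Real.pi / 2 * I by ring, exp_pi_div_two_mul_I]

theorem varsigma_mul_re (z : ℂ) : (varsigma * z).re = √2 / 2 * (z.re - z.im) := by
  rw [varsigma_eq, mul_assoc, re_ofReal_mul]
  simp only [add_mul, one_mul, add_re, I_mul_re]
  ring

theorem varsigma_mul_im (z : ℂ) : (varsigma * z).im = √2 / 2 * (z.re + z.im) := by
  rw [varsigma_eq, mul_assoc, im_ofReal_mul]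
  simp only [add_mul, one_mul, add_im, I_mul_im]
  ring

theorem mul_sq_add_conj_mul_norm_sq (p Φ : ℂ) :
    Φ * p ^ 2 + I * starRingEnd ℂ Φ * (‖p‖ : ℂ) ^ 2 =
      2 * ((starRingEnd ℂ varsigma * p * Φ).re : ℂ) * (varsigma * p) := by
  have hre := re_eq_add_conj (starRingEnd ℂ varsigma * p * Φ)
  simp only [map_mul, conj_conj] at hre
  rw [hre, ← conj_mul']
  linear_combination -Φ * p ^ 2 * conj_varsigma_mul_self -
    starRingEnd ℂ p * starRingEnd ℂ Φ * p * varsigma_sq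

theorem mul_sq_sub_add_conj_mul_norm_sq_sub {x : ℝ} {p q Φ : ℂ}
    (hp : (starRingEnd ℂ varsigma * p * Φ).re = x) (hq : (starRingEnd ℂ varsigma * q * Φ).re = x) :
    Φ * (p ^ 2 - q ^ 2) + I * starRingEnd ℂ Φ * ((‖p‖ : ℂ) ^ 2 - (‖q‖ : ℂ) ^ 2) =
      ((2 * x : ℝ) : ℂ) * (varsigma * (p - q)) := by
  have hp' := mul_sq_add_conj_mul_norm_sq p Φ
  have hq' := mul_sq_add_conj_mul_norm_sq q Φ
  rw [hp] at hp'
  rw [hq] at hq'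
  push_cast
  linear_combination hp' - hq'

theorem im_conj_mul_mul_eq {x : ℝ} {p q Φ : ℂ} (hp : (starRingEnd ℂ varsigma * p * Φ).re = x)
    (hq : (starRingEnd ℂ varsigma * q * Φ).re = x) :
    ((starRingEnd ℂ p * q).im : ℂ) * Φ = x * starRingEnd ℂ (varsigma * (p - q)) := by
  have hp' := re_eq_add_conj (starRingEnd ℂ varsigma * p * Φ)
  have hq' := re_eq_add_conj (starRingEnd ℂ varsigma * q * Φ)
  have him := im_eq_sub_conj (starRingEnd ℂ p * q)
  have hς : starRingEnd ℂ varsigma ^ 2 = -I := by rw [← map_pow, varsigma_sq, conj_I]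
  simp only [map_mul, map_sub, conj_conj, hp, hq] at hp' hq' him ⊢
  rw [him]
  field_simp
  linear_combination
    2 * I * starRingEnd ℂ varsigma * (starRingEnd ℂ q * hp' - starRingEnd ℂ p * hq') +
    (starRingEnd ℂ p * q - p * starRingEnd ℂ q) * Φ * (I_sq - I * hς)

/-- `p` and `q` are the square roots, in the first quadrant, of the vectors from the left and from
the right white vertex of a half-quad with a horizontal base to its apex. The half-quad is
non-degenerate in the sense that its sides have length at most `R ^ 2`, and that `Im (p̄ q)`, whose
ratio to `|p q|` is the sine of half the angle at the apex, is at least `2 R ^ 2 ε`. -/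
structure IsHalfQuad (R ε : ℝ) (p q : ℂ) : Prop where
  ε_pos : 0 < ε
  left_re : 0 < p.re
  left_im : 0 < p.im
  right_re : 0 < q.re
  right_im : 0 < q.im
  im_sq : (p ^ 2).im = (q ^ 2).im
  left_le : ‖p‖ ≤ R
  right_le : ‖q‖ ≤ R
  le_im : 2 * R ^ 2 * ε ≤ (starRingEnd ℂ p * q).im

section HalfQuad

variable {R ε : ℝ} {p q : ℂ}

theorem im_conj_mul_eq_of_im_sq_eq (h : (p ^ 2).im = (q ^ 2).im) :
    (starRingEnd ℂ p * q).im = (p.re - q.re) * (p.im + q.im) ∧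
      (starRingEnd ℂ p * q).im = (q.im - p.im) * (p.re + q.re) := by
  simp only [sq, mul_im, conj_re, conj_im] at h ⊢
  constructor <;> linarith

theorem im_conj_mul_pos (hp : 0 < p.re) (hp' : 0 < p.im) (hq : 0 < q.re) (hq' : 0 < q.im)
    (him : (p ^ 2).im = (q ^ 2).im) (hre : (q ^ 2).re < (p ^ 2).re) :
    0 < (starRingEnd ℂ p * q).im := by
  have hsq : 0 < (q ^ 2).im := by
    rw [sq, mul_im]
    positivity
  have hprod : 0 < 2 * (starRingEnd ℂ p * q).im * (starRingEnd ℂ p * q).re := by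
    rw [two_mul_im_conj_mul_mul_re, him]
    nlinarith
  have hcos : 0 < (starRingEnd ℂ p * q).re := by
    simp only [mul_re, conj_re, conj_im, neg_mul, sub_neg_eq_add]
    positivity
  linarith [(pos_iff_pos_of_mul_pos hprod).2 hcos]

namespace IsHalfQuad

theorem R_pos (h : IsHalfQuad R ε p q) : 0 < R :=
  h.left_re.trans_le ((re_le_norm p).trans h.left_le)

theorem im_conj_mul_pos (h : IsHalfQuad R ε p q) : 0 < (starRingEnd ℂ p * q).im := by
  have hR := h.R_pos
  have hε := h.ε_pos
  exact lt_of_lt_of_le (by positivity) h.le_im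

theorem mul_le_of_im_conj_mul_eq {u s : ℝ} (h : IsHalfQuad R ε p q) (hs : 0 < s)
    (hs' : s ≤ 2 * R) (hu : (starRingEnd ℂ p * q).im = u * s) : R * ε ≤ u := by
  have hRε : 0 < R * ε := mul_pos h.R_pos h.ε_pos
  by_contra! hlt
  refine h.le_im.not_gt ?_
  calc (starRingEnd ℂ p * q).im = u * s := hu
    _ < R * ε * s := mul_lt_mul_of_pos_right hlt hs
    _ ≤ R * ε * (2 * R) := mul_le_mul_of_nonneg_left hs' hRε.le
    _ = 2 * R ^ 2 * ε := by ring

theorem re_sub_mem_Icc (h : IsHalfQuad R ε p q) : p.re - q.re ∈ Set.Icc (R * ε) R := by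
  have hp := (im_le_norm p).trans h.left_le
  have hq := (im_le_norm q).trans h.right_le
  constructor
  · exact h.mul_le_of_im_conj_mul_eq (add_pos h.left_im h.right_im) (by linarith)
      (im_conj_mul_eq_of_im_sq_eq h.im_sq).1
  · linarith [(re_le_norm p).trans h.left_le, h.right_re]

theorem im_sub_mem_Icc (h : IsHalfQuad R ε p q) : q.im - p.im ∈ Set.Icc (R * ε) R := by
  have hp := (re_le_norm p).trans h.left_le
  have hq := (re_le_norm q).trans h.right_le
  constructor
  · exact h.mul_le_of_im_conj_mul_eq (add_pos h.left_re h.right_re) (by linarith)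
      (im_conj_mul_eq_of_im_sq_eq h.im_sq).2
  · linarith [(im_le_norm q).trans h.right_le, h.left_im]

theorem ε_le_one (h : IsHalfQuad R ε p q) : ε ≤ 1 := by
  obtain ⟨hu, hu'⟩ := h.re_sub_mem_Icc
  exact le_of_mul_le_mul_left (by linarith) h.R_pos

theorem mul_le_re (h : IsHalfQuad R ε p q) : R * ε ≤ (varsigma * (p - q)).re := by
  have hu := h.re_sub_mem_Icc.1
  have hv := h.im_sub_mem_Icc.1
  have hRε : 0 < R * ε := mul_pos h.R_pos h.ε_pos
  rw [varsigma_mul_re, sub_re, sub_im]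
  calc R * ε ≤ √2 / 2 * (2 * (R * ε)) := by
        linarith [mul_le_mul_of_nonneg_right Real.one_lt_sqrt_two.le hRε.le]
    _ ≤ √2 / 2 * (p.re - q.re - (p.im - q.im)) := by
        gcongr
        linarith

theorem abs_im_le (h : IsHalfQuad R ε p q) :
    |(varsigma * (p - q)).im| ≤ (1 - ε) * (varsigma * (p - q)).re := by
  obtain ⟨hu, hu'⟩ := h.re_sub_mem_Icc
  obtain ⟨hv, hv'⟩ := h.im_sub_mem_Icc
  have hε := h.ε_pos
  have hεu : ε * (p.re - q.re) ≤ R * ε := by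
    rw [mul_comm]
    gcongr
  have hεv : ε * (q.im - p.im) ≤ R * ε := by
    rw [mul_comm]
    gcongr
  have habs : |p.re - q.re + (p.im - q.im)| ≤ (1 - ε) * (p.re - q.re - (p.im - q.im)) := by
    rw [abs_le]
    constructor <;> nlinarith
  rw [varsigma_mul_im, varsigma_mul_re, sub_re, sub_im, abs_mul, abs_of_nonneg (by positivity),
    mul_left_comm]
  gcongr

theorem norm_le (h : IsHalfQuad R ε p q) : ‖varsigma * (p - q)‖ ≤ 2 * R := by
  rw [norm_mul, norm_varsigma, one_mul]
  linarith [norm_sub_le p q, h.left_le, h.right_le]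

theorem re_nonneg (h : IsHalfQuad R ε p q) : 0 ≤ (varsigma * (p - q)).re :=
  (mul_pos h.R_pos h.ε_pos).le.trans h.mul_le_re

variable {φ x : ℝ} {Φ : ℂ}

theorem re_mul_exp_nonneg (h : IsHalfQuad R ε p q) (hφ : |φ| ≤ Real.pi / 4 + ε / 8) (hx : 0 ≤ x)
    (hp : (starRingEnd ℂ varsigma * p * Φ).re = x) (hq : (starRingEnd ℂ varsigma * q * Φ).re = x) :
    0 ≤ (Φ * exp (φ * I)).re := by
  have hcone := re_exp_mul_I_mul_ge (w := starRingEnd ℂ (varsigma * (p - q))) h.ε_pos.le h.ε_le_one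
    (by rw [conj_re]; exact h.re_nonneg) (by rw [conj_re, conj_im, abs_neg]; exact h.abs_im_le) hφ
  have hΦ : (starRingEnd ℂ p * q).im * (Φ * exp (φ * I)).re =
      x * (exp (φ * I) * starRingEnd ℂ (varsigma * (p - q))).re := by
    rw [← re_ofReal_mul, ← re_ofReal_mul, mul_left_comm (x : ℂ), ← im_conj_mul_mul_eq hp hq]
    congr 1
    ring
  have hε := h.ε_pos
  have hre := h.re_nonneg
  rw [conj_re] at hcone
  refine nonneg_of_mul_nonneg_right ?_ h.im_conj_mul_pos
  rw [hΦ]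
  exact mul_nonneg hx (hcone.trans' (by positivity))

theorem re_exp_mul_increment_mem_Icc (h : IsHalfQuad R ε p q) (hφ : |φ| ≤ Real.pi / 4 + ε / 8)
    (hx : 0 ≤ x) (hp : (starRingEnd ℂ varsigma * p * Φ).re = x)
    (hq : (starRingEnd ℂ varsigma * q * Φ).re = x) :
    (exp (φ * I) * (Φ * (p ^ 2 - q ^ 2) +
        I * starRingEnd ℂ Φ * ((‖p‖ : ℂ) ^ 2 - (‖q‖ : ℂ) ^ 2))).re ∈
      Set.Icc (R * ε ^ 2 / 2 * x) (4 * R * x) := by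
  set w := varsigma * (p - q)
  have hlower : R * ε ^ 2 / 4 ≤ (exp (φ * I) * w).re :=
    calc R * ε ^ 2 / 4 = ε / 4 * (R * ε) := by ring
      _ ≤ ε / 4 * w.re := mul_le_mul_of_nonneg_left h.mul_le_re (by linarith [h.ε_pos])
      _ ≤ (exp (φ * I) * w).re :=
        re_exp_mul_I_mul_ge h.ε_pos.le h.ε_le_one h.re_nonneg h.abs_im_le hφ
  have hupper : (exp (φ * I) * w).re ≤ 2 * R := by
    refine (re_le_norm _).trans ?_
    rw [norm_mul, norm_exp_ofReal_mul_I, one_mul]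
    exact h.norm_le
  rw [mul_sq_sub_add_conj_mul_norm_sq_sub hp hq, mul_left_comm, re_ofReal_mul]
  constructor <;> nlinarith

end IsHalfQuad

end HalfQuad

/-- The opening `ε` of half-quads with sides of length between `r⁻¹` and `r` and with angle at least
`θ` at the apex, in the sense of `IsHalfQuad r ε`. Angles are at most `π`, so the bound is taken at
`min θ π`. -/
noncomputable def aperture (r θ : ℝ) : ℝ := Real.sin (min θ Real.pi / 2) / (2 * r ^ 3)

theorem aperture_pos {r θ : ℝ} (hr : 0 < r) (hθ : 0 < θ) : 0 < aperture r θ := by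
  have hmin : 0 < min θ Real.pi := lt_min hθ Real.pi_pos
  have hsin : 0 < Real.sin (min θ Real.pi / 2) :=
    Real.sin_pos_of_pos_of_lt_pi (by linarith) (by linarith [min_le_right θ Real.pi, Real.pi_pos])
  rw [aperture]
  positivity

theorem four_mul_le_two_div_aperture {r θ : ℝ} (hr : 1 ≤ r) (hθ : 0 < θ) :
    4 * r ≤ 2 / (r * aperture r θ ^ 2) := by
  have hr0 : 0 < r := by linarith
  have hε := aperture_pos hr0 hθ
  have hle : r ^ 3 * aperture r θ ≤ 1 / 2 := by
    rw [aperture, mul_div_assoc', div_le_iff₀ (by positivity)]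
    nlinarith [Real.sin_le_one (min θ Real.pi / 2), pow_pos hr0 3]
  have hle' : r * aperture r θ ≤ 1 / 2 :=
    hle.trans' (mul_le_mul_of_nonneg_right (le_self_pow₀ hr three_ne_zero) hε.le)
  rw [le_div_iff₀ (by positivity)]
  nlinarith [mul_pos hr0 hε]

theorem mul_aperture_le_abs_im {r θ : ℝ} {a b c p q : ℂ} (hr : 0 < r) (hθ : 0 < θ)
    (hp : p ^ 2 = c - a) (hq : q ^ 2 = c - b) (ha : r⁻¹ ≤ ‖c - a‖) (hb : r⁻¹ ≤ ‖c - b‖)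
    (hangle : θ ≤ EuclideanGeometry.angle a c b) :
    2 * r ^ 2 * aperture r θ ≤ |(starRingEnd ℂ p * q).im| := by
  have hmin : min θ Real.pi ≤ EuclideanGeometry.angle a c b := (min_le_left _ _).trans hangle
  have hmin0 : 0 < min θ Real.pi := lt_min hθ Real.pi_pos
  have hπ := EuclideanGeometry.angle_le_pi a c b
  have hsin : Real.sin (min θ Real.pi / 2) ≤ Real.sin (EuclideanGeometry.angle a c b / 2) :=
    Real.sin_le_sin_of_le_of_le_pi_div_two (by linarith [Real.pi_pos]) (by linarith) (by linarith)
  have hsin0 : 0 ≤ Real.sin (min θ Real.pi / 2) :=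
    Real.sin_nonneg_of_nonneg_of_le_pi (by linarith) (by linarith)
  have hnorm : r⁻¹ ≤ ‖p‖ * ‖q‖ := by
    rw [← hp, norm_pow] at ha
    rw [← hq, norm_pow] at hb
    refine le_of_sq_le_sq ?_ (by positivity)
    rw [sq, mul_pow]
    exact mul_le_mul ha hb (by positivity) (by positivity)
  calc 2 * r ^ 2 * aperture r θ = Real.sin (min θ Real.pi / 2) * r⁻¹ := by
        rw [aperture]
        field_simp
    _ ≤ Real.sin (EuclideanGeometry.angle a c b / 2) * (‖p‖ * ‖q‖) :=
        mul_le_mul hsin hnorm (by positivity) (hsin0.trans hsin)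
    _ = |(starRingEnd ℂ p * q).im| := sin_half_angle_mul_norm hp hq

variable {B W Q : Type} {n m : ℕ}

/-- The value of `𝒳` at the corner `(v y)`, at the lift where its real part is non-negative. -/
noncomputable def cornerSqrt (E : EmbeddingData B W Q n m) (v : B) (y : W) : ℂ :=
  Complex.sqrt (E.black v - E.white y)

theorem UnifHalfQuad.isHalfQuad {D : DomainData B W Q n m}
    {E : EmbeddingData B W Q n m} {r θ : ℝ} {k : Fin n} (hU : D.UnifHalfQuad E r θ k) (hr : 1 ≤ r)
    (hθ : 0 < θ) (hre : (E.white (D.wired k.castSucc)).re < (E.white (D.wired k.succ)).re)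
    (him : (E.white (D.wired k.succ)).im = (E.white (D.wired k.castSucc)).im)
    (hapex : (E.white (D.wired k.castSucc)).im < (E.black (D.apex k)).im) :
    IsHalfQuad r (aperture r θ) (cornerSqrt E (D.apex k) (D.wired k.castSucc))
      (cornerSqrt E (D.apex k) (D.wired k.succ)) := by
  have hr0 : 0 < r := by linarith
  have hp : 0 < (E.black (D.apex k) - E.white (D.wired k.castSucc)).im := by
    rw [sub_im]
    linarith
  have hq : 0 < (E.black (D.apex k) - E.white (D.wired k.succ)).im := by
    rw [sub_im]
    linarith
  have hsqrt_le {d : ℂ} (hd : ‖d‖ ≤ r) : ‖d.sqrt‖ ≤ r := by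
    refine le_of_sq_le_sq ?_ hr0.le
    rw [norm_csqrt_sq]
    nlinarith
  have him_sq : (cornerSqrt E (D.apex k) (D.wired k.castSucc) ^ 2).im =
      (cornerSqrt E (D.apex k) (D.wired k.succ) ^ 2).im := by
    rw [cornerSqrt, cornerSqrt, csqrt_sq, csqrt_sq, sub_im, sub_im, him]
  refine ⟨aperture_pos hr0 hθ, csqrt_re_pos hp, csqrt_im_pos hp, csqrt_re_pos hq, csqrt_im_pos hq,
    him_sq, hsqrt_le hU.left_le, hsqrt_le hU.right_le, ?_⟩
  have hδ := mul_aperture_le_abs_im hr0 hθ (csqrt_sq _) (csqrt_sq _) hU.left_ge hU.right_ge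
    hU.angle_ge
  rwa [abs_of_pos] at hδ
  refine im_conj_mul_pos (csqrt_re_pos hp) (csqrt_im_pos hp) (csqrt_re_pos hq) (csqrt_im_pos hq)
    him_sq ?_
  rw [csqrt_sq, csqrt_sq, sub_re, sub_re]
  linarith

theorem IsDisorderLine.symmDiff_singleton [DecidableEq Q] {D : DomainData B W Q n m} {z : Q}
    {γ : Finset Q} {v v' : B} (hγ : D.IsDisorderLine v γ) (hne : v ≠ v')
    (hz : ∀ x, (∃ p, D.b z p = x) ↔ x = v ∨ x = v') :
    D.IsDisorderLine v' (symmDiff γ {z}) := by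
  classical
  intro x hx
  have hncard (γ : Finset Q) : {z | z ∈ γ ∧ ∃ p, D.b z p = x}.ncard =
      (γ.filter fun z => ∃ p, D.b z p = x).card := by
    rw [← Set.ncard_coe_finset, Finset.coe_filter]
  have hodd := hγ x hx
  have hfilter : (symmDiff γ {z}).filter (fun z => ∃ p, D.b z p = x) =
      symmDiff (γ.filter fun z => ∃ p, D.b z p = x)
        (({z} : Finset Q).filter fun z => ∃ p, D.b z p = x) := by
    ext z'
    simp only [Finset.mem_filter, Finset.mem_symmDiff]
    tauto
  rw [hncard] at hodd ⊢
  rw [hfilter, Finset.filter_singleton]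
  split_ifs with hzx
  · rw [odd_card_symmDiff_singleton, hodd]
    rcases (hz x).1 hzx with rfl | rfl
    · exact iff_of_false (not_not_intro rfl) hne
    · exact iff_of_true hne.symm rfl
  · rw [hz, not_or] at hzx
    rw [← Finset.bot_eq_empty, symmDiff_bot, hodd]
    exact iff_of_false hzx.1 hzx.2

theorem IsDisorderLine.exists_of_adj {D : DomainData B W Q n m} {v v' : B} {γ : Finset Q}
    (hγ : D.IsDisorderLine v γ) (hadj : D.blackGraph.Adj v v') : ∃ γ', D.IsDisorderLine v' γ' := by
  classical
  have of_free (hv : v ∈ Set.range D.free) (hv' : v' ∈ Set.range D.free) :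
      ∃ γ', D.IsDisorderLine v' γ' := by
    refine ⟨γ, fun x hx => ?_⟩
    rw [hγ x hx]
    exact iff_of_false (fun h => hx (h ▸ hv)) (fun h => hx (h ▸ hv'))
  rw [blackGraph, SimpleGraph.fromRel_adj] at hadj
  obtain ⟨hne, (⟨z, hz⟩ | h) | (⟨z, hz⟩ | h)⟩ := hadj
  · refine ⟨_, hγ.symmDiff_singleton (z := z) hne fun x => ?_⟩
    rw [Fin.exists_fin_two, hz.1, hz.2, eq_comm, eq_comm (a := v')]
  · exact of_free h.1 h.2
  · refine ⟨_, hγ.symmDiff_singleton (z := z) hne fun x => ?_⟩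
    rw [Fin.exists_fin_two, hz.1, hz.2, eq_comm, eq_comm (a := v), or_comm]
  · exact of_free h.2 h.1

theorem exists_isDisorderLine {D : DomainData B W Q n m} (hconn : D.blackGraph.Preconnected)
    (v : B) : ∃ γ, D.IsDisorderLine v γ := by
  have hfree : ∃ γ, D.IsDisorderLine (D.free 0) γ := by
    refine ⟨∅, fun x hx => iff_of_false ?_ fun h => hx (h ▸ Set.mem_range_self 0)⟩
    simp
  obtain ⟨walk⟩ := hconn (D.free 0) v
  generalize D.free 0 = u at walk hfree
  induction walk with
  | nil => exact hfree
  | cons hadj _ ih =>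
    obtain ⟨γ, hγ⟩ := hfree
    exact ih (hγ.exists_of_adj hadj)

theorem spin_mul_self (σ : W → ℤˣ) (y : W) : spin σ y * spin σ y = 1 := by
  rw [spin, ← Int.cast_mul, ← Units.val_mul, Int.units_mul_self, Units.val_one, Int.cast_one]

section Ising

variable [Fintype W] [Fintype Q] (D : DomainData B W Q n m)

theorem fkObservable_wired (i : Fin (n + 1)) (γ : Finset Q) :
    D.fkObservable (D.wired i) γ = D.fkObservable (D.wired 0) γ := by
  unfold fkObservable expect
  congr 1
  refine Finset.sum_congr rfl fun σ hσ => ?_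
  have hσ : σ (D.wired i) = σ (D.wired 0) := (Finset.mem_filter.1 hσ).2 i
  simp only [spin, hσ]

theorem fkObservable_wired_pos (i : Fin (n + 1)) (γ : Finset Q) :
    0 < D.fkObservable (D.wired i) γ := by
  have hconfigs : D.configs.Nonempty := ⟨fun _ => 1, by simp [configs]⟩
  rw [fkObservable_wired]
  refine div_pos (Finset.sum_pos (fun σ _ => ?_) hconfigs)
    (Finset.sum_pos (fun σ _ => Real.exp_pos _) hconfigs)
  simp only [spin_mul_self, one_mul]
  exact mul_pos (Real.exp_pos _) (Finset.prod_pos fun _ _ => Real.exp_pos _)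

theorem quadValue_mul_pos [DecidableEq Q] {i : Fin (n + 1)} {z : Q} {q : Fin 2}
    (hq : D.w z q = D.wired i) (γ : Finset Q) :
    0 < (-1) ^ (q : ℕ) * (D.quadValue z γ 0 q * D.quadValue z γ 1 q) := by
  have hpos := mul_pos (D.fkObservable_wired_pos i γ) (D.fkObservable_wired_pos i (symmDiff γ {z}))
  fin_cases q
  · simpa [quadValue, hq.symm] using hpos
  · by_cases hz : z ∈ γ <;> simpa [quadValue, hz, hq.symm] using hpos

end Ising

/-- `E` is an s-embedding that need be neither proper nor non-degenerate, and whose angles are not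
tied to the couplings of the Ising model. -/
structure IsWeakSEmbedding (D : DomainData B W Q n m) (E : EmbeddingData B W Q n m) : Prop where
  θ_mem : ∀ f, E.θ f ∈ Set.Ioo 0 (Real.pi / 2)
  sq : ∀ f p q, D.bpos E f p - D.wpos E f q = E.X f p q ^ 2
  threeTerm : ∀ f, ThreeTerm (E.θ f) (E.X f)

theorem IsSEmbedding.isWeakSEmbedding {D : DomainData B W Q n m} {E : EmbeddingData B W Q n m}
    (hE : D.IsSEmbedding E) : D.IsWeakSEmbedding E :=
  ⟨hE.θ_mem, hE.sq, hE.threeTerm⟩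

theorem ThreeTerm.zero_sub {θ : ℝ} {X : Fin 2 → Fin 2 → ℂ} (h : ThreeTerm θ X) (q : Fin 2) :
    X 0 q - Real.sin θ * ((-1) ^ (q : ℕ) * X 1 q) = Real.cos θ * X 0 (1 - q) := by
  obtain ⟨h₀₀, -, h₀₁, -⟩ := h
  fin_cases q
  · simp only [Fin.zero_eta, sub_zero]
    linear_combination h₀₀
  · simp only [Fin.mk_one, sub_self]
    linear_combination h₀₁

/-- The value of `Re[ς̄ 𝒳 F(f)]` at the corner `(v y)` of the face `f`, at the lift of this corner
where `𝒳` has a non-negative real part. -/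
noncomputable def cornerValue (E : EmbeddingData B W Q n m) (F : Face Q n m → ℂ) (f : Face Q n m)
    (v : B) (y : W) : ℝ :=
  (starRingEnd ℂ varsigma * cornerSqrt E v y * F f).re

theorem conj_eta (E : EmbeddingData B W Q n m) (v : B) (y : W) :
    starRingEnd ℂ (eta E v y) =
      starRingEnd ℂ varsigma * exp (I / 2 * (arg (E.black v - E.white y) : ℂ)) := by
  rw [eta, map_mul, ← exp_conj]
  congr 2
  simp only [map_mul, map_neg, map_div₀, conj_I, conj_ofReal, conj_ofNat]
  ring

theorem norm_eta (E : EmbeddingData B W Q n m) (v : B) (y : W) : ‖eta E v y‖ = 1 := by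
  rw [eta, norm_mul, norm_varsigma, norm_exp]
  simp

theorem cornerValue_eq_norm_mul_re (E : EmbeddingData B W Q n m) (F : Face Q n m → ℂ)
    (f : Face Q n m) (v : B) (y : W) :
    cornerValue E F f v y = ‖cornerSqrt E v y‖ * (starRingEnd ℂ (eta E v y) * F f).re := by
  rw [cornerValue, ← re_ofReal_mul, conj_eta, cornerSqrt]
  congr 1
  linear_combination
    starRingEnd ℂ varsigma * F f * csqrt_eq_norm_mul_exp (E.black v - E.white y)

theorem IsSHolomorphic.cornerValue_eq {D : DomainData B W Q n m} {E : EmbeddingData B W Q n m}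
    {F : Face Q n m → ℂ} (h : D.IsSHolomorphic E F) {f g : Face Q n m} {v : B} {y : W}
    (hf : D.HasCorner f v y) (hg : D.HasCorner g v y) :
    cornerValue E F f v y = cornerValue E F g v y := by
  have hproj := h f g v y hf hg
  have hη : eta E v y ≠ 0 := norm_ne_zero_iff.1 (by rw [norm_eta]; exact one_ne_zero)
  rw [Submodule.starProjection_singleton, Submodule.starProjection_singleton, norm_eta] at hproj
  have hinner := smul_left_injective ℝ hη hproj
  rw [cornerValue_eq_norm_mul_re, cornerValue_eq_norm_mul_re]
  simp only [RCLike.ofReal_one, one_pow, div_one, Complex.inner] at hinner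
  rw [mul_comm _ (F f), mul_comm _ (F g), hinner]

section LocalSigns

variable {D : DomainData B W Q n m} {E : EmbeddingData B W Q n m} {F : Face Q n m → ℂ}
  {f : Face Q n m} {p q p' q' : Fin 2} {v v' : B} {y y' : W}

namespace IsWeakSEmbedding

theorem X_eq_or_eq_neg (hE : D.IsWeakSEmbedding E) (hp : D.bpos E f p = E.black v)
    (hq : D.wpos E f q = E.white y) :
    E.X f p q = cornerSqrt E v y ∨ E.X f p q = -cornerSqrt E v y := by
  rw [← sq_eq_sq_iff_eq_or_eq_neg, cornerSqrt, csqrt_sq, ← hE.sq, hp, hq]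

theorem abs_spinorOf (hE : D.IsWeakSEmbedding E) (hp : D.bpos E f p = E.black v)
    (hq : D.wpos E f q = E.white y) : |spinorOf E F f p q| = |cornerValue E F f v y| := by
  rw [spinorOf, cornerValue]
  rcases hE.X_eq_or_eq_neg hp hq with hX | hX <;>
    simp only [hX, mul_neg, neg_mul, neg_re, abs_neg]

theorem im_mul_spinorOf_mul (hE : D.IsWeakSEmbedding E) (hp : D.bpos E f p = E.black v)
    (hq : D.wpos E f q = E.white y) (hp' : D.bpos E f p' = E.black v')
    (hq' : D.wpos E f q' = E.white y') :
    (E.X f p q * E.X f p' q').im * (spinorOf E F f p q * spinorOf E F f p' q') =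
      (cornerSqrt E v y * cornerSqrt E v' y').im *
        (cornerValue E F f v y * cornerValue E F f v' y') := by
  simp only [spinorOf, cornerValue]
  rcases hE.X_eq_or_eq_neg hp hq with hX | hX <;>
    rcases hE.X_eq_or_eq_neg hp' hq' with hX' | hX' <;>
      simp only [hX, hX', mul_neg, neg_mul, neg_re, neg_im, neg_neg]

theorem cornerValue_pos_iff (hE : D.IsWeakSEmbedding E) (hp : D.bpos E f p = E.black v)
    (hq : D.wpos E f q = E.white y) (hp' : D.bpos E f p' = E.black v')
    (hq' : D.wpos E f q' = E.white y') (him : (E.white y).im < (E.black v).im)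
    (him' : (E.white y').im < (E.black v').im)
    (hmul : 0 < (E.X f p q * E.X f p' q').im * (spinorOf E F f p q * spinorOf E F f p' q')) :
    0 < cornerValue E F f v y ↔ 0 < cornerValue E F f v' y' := by
  rw [hE.im_mul_spinorOf_mul hp hq hp' hq'] at hmul
  rw [← sub_pos, ← sub_im] at him him'
  refine pos_iff_pos_of_mul_pos (pos_of_mul_pos_right hmul ?_)
  have hre := csqrt_re_pos him
  have hre' := csqrt_re_pos him'
  have him := csqrt_im_pos him
  have him' := csqrt_im_pos him'
  rw [cornerSqrt, cornerSqrt, mul_im]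
  positivity

theorem im_X_mul_X_of_above (hE : D.IsWeakSEmbedding E)
    (hb : ∀ p, (D.wpos E f q).im < (D.bpos E f p).im)
    (hw : ∀ q', (D.wpos E f q).im ≤ (D.wpos E f q').im) :
    0 < (-1) ^ (q : ℕ) * (E.X f 0 q * E.X f 1 q).im := by
  have hθ := hE.θ_mem f
  have hsin : 0 < Real.sin (E.θ f) :=
    Real.sin_pos_of_pos_of_lt_pi hθ.1 (by linarith [hθ.2, Real.pi_pos])
  have him : 0 < (E.X f 0 q * ((-1) ^ (q : ℕ) * E.X f 1 q)).im := by
    refine im_mul_pos_of_im_sq_sub_le hsin ?_ ?_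
    · rw [mul_pow, ← pow_mul, mul_comm (q : ℕ), pow_mul, neg_one_sq, one_pow, one_mul, ← hE.sq,
        sub_im, sub_pos]
      exact hb 1
    · rw [(hE.threeTerm f).zero_sub, mul_pow, ← ofReal_pow, im_ofReal_mul, ← hE.sq, ← hE.sq,
        sub_im, sub_im]
      nlinarith [Real.cos_sq_le_one (E.θ f), sq_nonneg (Real.cos (E.θ f)), hb 0, hw (1 - q)]
  have hcast : ((-1) ^ (q : ℕ) : ℂ) = (((-1) ^ (q : ℕ) : ℝ) : ℂ) := by push_cast; rfl
  rwa [hcast, mul_left_comm, im_ofReal_mul] at him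

theorem im_X_mul_X_of_below (hE : D.IsWeakSEmbedding E)
    (h₀ : ∀ q, (D.wpos E f q).im < (D.bpos E f 0).im)
    (h₁ : (D.bpos E f 1).im ≤ (D.wpos E f 0).im) : 0 < (E.X f 0 0 * E.X f 0 1).im := by
  have hθ := hE.θ_mem f
  have hcos : 0 < Real.cos (E.θ f) :=
    Real.cos_pos_of_mem_Ioo ⟨by linarith [hθ.1, Real.pi_pos], hθ.2⟩
  refine im_mul_pos_of_im_sq_sub_le hcos ?_ ?_
  · rw [← hE.sq, sub_im, sub_pos]
    exact h₀ 1
  · have hX : E.X f 0 0 - Real.cos (E.θ f) * E.X f 0 1 = Real.sin (E.θ f) * E.X f 1 0 := by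
      linear_combination (hE.threeTerm f).1
    rw [hX, mul_pow, ← ofReal_pow, im_ofReal_mul, ← hE.sq, ← hE.sq, sub_im, sub_im]
    nlinarith [sq_nonneg (Real.sin (E.θ f)), h₀ 0]

theorem cornerValue_pos_iff_of_above (hE : D.IsWeakSEmbedding E) {v : Fin 2 → B}
    (hv : ∀ p, D.bpos E f p = E.black (v p)) (hy : D.wpos E f q = E.white y)
    (hb : ∀ p, (E.white y).im < (E.black (v p)).im)
    (hw : ∀ q', (E.white y).im ≤ (D.wpos E f q').im)
    (hs : 0 < (-1) ^ (q : ℕ) * (spinorOf E F f 0 q * spinorOf E F f 1 q)) (p p' : Fin 2) :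
    0 < cornerValue E F f (v p) y ↔ 0 < cornerValue E F f (v p') y := by
  have him := hE.im_X_mul_X_of_above (fun p => by rw [hv, hy]; exact hb p)
    (fun q' => by rw [hy]; exact hw q')
  have h01 : 0 < cornerValue E F f (v 0) y ↔ 0 < cornerValue E F f (v 1) y := by
    refine hE.cornerValue_pos_iff (hv 0) hy (hv 1) hy (hb 0) (hb 1) ?_
    have hmul := mul_pos him hs
    rwa [mul_mul_mul_comm, ← mul_pow, neg_one_mul, neg_neg, one_pow, one_mul] at hmul
  fin_cases p <;> fin_cases p'
  exacts [Iff.rfl, h01, h01.symm, Iff.rfl]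

end IsWeakSEmbedding

end LocalSigns

/-- The faces around the white vertex `y` form a single fan: any two of them are linked by a chain
of faces in which consecutive ones share a corner at `y`. -/
def IsFan (D : DomainData B W Q n m) (y : W) : Prop :=
  ∀ f g, (∃ v, D.HasCorner f v y) → (∃ v, D.HasCorner g v y) →
    Relation.ReflTransGen (fun f g => ∃ v, D.HasCorner f v y ∧ D.HasCorner g v y) f g

namespace IsFKFunction

variable [Fintype W] [Fintype Q] [DecidableEq Q] {D : DomainData B W Q n m}
  {E : EmbeddingData B W Q n m} {F : Face Q n m → ℂ}

theorem spinorOf_quad_mul_pos (hF : D.IsFKFunction E F) {z : Q} {q : Fin 2} {i : Fin (n + 1)}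
    {γ : Finset Q} (hγ : D.IsDisorderLine (D.b z 0) γ) (hq : D.w z q = D.wired i) :
    0 < (-1) ^ (q : ℕ) * (spinorOf E F (Sum.inl z) 0 q * spinorOf E F (Sum.inl z) 1 q) := by
  obtain ⟨s, hs, hX⟩ := hF.quad z γ hγ
  have hpos := D.quadValue_mul_pos hq γ
  rwa [hX, hX, mul_mul_mul_comm, mul_self_eq_one_iff.2 hs, one_mul] at hpos

theorem spinorOf_freeFace_mul_pos (hF : D.IsFKFunction E F) {j : Fin m} {i : Fin (n + 1)}
    {γ : Finset Q} (hγ : D.IsDisorderLine (D.free j.castSucc) γ) (hj : D.freeApex j = D.wired i) :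
    0 < spinorOf E F (freeFace j) 0 0 * spinorOf E F (freeFace j) 1 0 := by
  obtain ⟨s, hs, h₀, h₁⟩ := hF.freeHalf j γ hγ
  have hpos := D.fkObservable_wired_pos i γ
  rw [← hj] at hpos
  have hmul := mul_pos hpos hpos
  nth_rewrite 1 [h₀] at hmul
  rwa [h₁, mul_mul_mul_comm, mul_self_eq_one_iff.2 hs, one_mul] at hmul

theorem spinorOf_wiredFace_mul_pos (hF : D.IsFKFunction E F) {k : Fin n} {γ : Finset Q}
    (hγ : D.IsDisorderLine (D.apex k) γ) :
    0 < spinorOf E F (wiredFace k) 0 0 * spinorOf E F (wiredFace k) 0 1 := by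
  obtain ⟨s, hs, h₀, h₁⟩ := hF.wiredHalf k γ hγ
  have hmul := mul_pos (D.fkObservable_wired_pos k.castSucc γ) (D.fkObservable_wired_pos k.succ γ)
  rwa [h₀, h₁, mul_mul_mul_comm, mul_self_eq_one_iff.2 hs, one_mul] at hmul

theorem abs_spinorOf_wiredFace (hF : D.IsFKFunction E F) {k : Fin n} {γ : Finset Q}
    (hγ : D.IsDisorderLine (D.apex k) γ) (i : Fin (n + 1)) (q : Fin 2) :
    |spinorOf E F (wiredFace k) 0 q| = |D.fkObservable (D.wired i) γ| := by
  obtain ⟨s, hs, h₀, h₁⟩ := hF.wiredHalf k γ hγ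
  have hs' : |s| = 1 := by rcases hs with rfl | rfl <;> norm_num
  rw [fkObservable_wired] at h₀ h₁
  rw [fkObservable_wired]
  fin_cases q
  · rw [h₀, abs_mul, hs', one_mul]; rfl
  · rw [h₁, abs_mul, hs', one_mul]; rfl

end IsFKFunction

theorem IsHorizontalLayer.im_apex_of_succ {D : DomainData B W Q n m}
    {E : EmbeddingData B W Q n m} {k₀ k₁ : ℕ} (hL : D.IsHorizontalLayer E k₀ k₁) {k : Fin n}
    (hk₀ : k₀ ≤ k) (hk₁ : k < k₁) : (E.white (D.wired k.succ)).im < (E.black (D.apex k)).im :=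
  (hL.im_eq k hk₀ hk₁).trans_lt (hL.im_apex k hk₀ hk₁)

section Layer

variable [Fintype W] [Fintype Q] [DecidableEq Q] {D : DomainData B W Q n m}
  {E : EmbeddingData B W Q n m} {F : Face Q n m → ℂ} {k₀ k₁ : ℕ}

namespace IsHorizontalLayer

theorem cornerValue_pos_iff_of_quad (hL : D.IsHorizontalLayer E k₀ k₁)
    (hE : D.IsWeakSEmbedding E) (hF : D.IsFKFunction E F) {i : Fin (n + 1)} (hi₀ : k₀ < i)
    (hi₁ : i < k₁) {z : Q} {q : Fin 2} {γ : Finset Q} (hγ : D.IsDisorderLine (D.b z 0) γ)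
    (hq : D.w z q = D.wired i) (p p' : Fin 2) :
    0 < cornerValue E F (Sum.inl z) (D.b z p) (D.wired i) ↔
      0 < cornerValue E F (Sum.inl z) (D.b z p') (D.wired i) := by
  have habove (p : Fin 2) := hL.above i hi₀ hi₁ (Sum.inl z) (D.b z p) ⟨⟨p, rfl⟩, ⟨q, hq⟩⟩
  exact hE.cornerValue_pos_iff_of_above (f := Sum.inl z) (fun _ => rfl) (congrArg E.white hq)
    (fun p => (habove p).1) (habove 0).2 (hF.spinorOf_quad_mul_pos hγ hq) p p'

theorem cornerValue_pos_iff_of_freeFace (hL : D.IsHorizontalLayer E k₀ k₁)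
    (hE : D.IsWeakSEmbedding E) (hF : D.IsFKFunction E F) {i : Fin (n + 1)} (hi₀ : k₀ < i)
    (hi₁ : i < k₁) {j : Fin m} {γ : Finset Q} (hγ : D.IsDisorderLine (D.free j.castSucc) γ)
    (hj : D.freeApex j = D.wired i) (p p' : Fin 2) :
    0 < cornerValue E F (freeFace j) (![D.free j.castSucc, D.free j.succ] p) (D.wired i) ↔
      0 < cornerValue E F (freeFace j) (![D.free j.castSucc, D.free j.succ] p') (D.wired i) := by
  have habove (p : Fin 2) :=
    hL.above i hi₀ hi₁ (freeFace j) (![D.free j.castSucc, D.free j.succ] p)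
      ⟨by fin_cases p; exacts [Or.inl rfl, Or.inr rfl], hj⟩
  refine hE.cornerValue_pos_iff_of_above (f := freeFace j) (q := 0) (fun p => ?_)
    (congrArg E.white hj) (fun p => (habove p).1) (habove 0).2 ?_ p p'
  · fin_cases p <;> rfl
  · rw [Fin.val_zero, pow_zero, one_mul]
    exact hF.spinorOf_freeFace_mul_pos hγ hj

theorem cornerValue_pos_iff_of_face (hL : D.IsHorizontalLayer E k₀ k₁)
    (hconn : D.blackGraph.Preconnected) (hE : D.IsWeakSEmbedding E) (hF : D.IsFKFunction E F)
    {i : Fin (n + 1)} (hi₀ : k₀ < i) (hi₁ : i < k₁) {f : Face Q n m} {v v' : B}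
    (hv : D.HasCorner f v (D.wired i)) (hv' : D.HasCorner f v' (D.wired i)) :
    0 < cornerValue E F f v (D.wired i) ↔ 0 < cornerValue E F f v' (D.wired i) := by
  match f with
  | Sum.inl z =>
    obtain ⟨⟨p, rfl⟩, ⟨q, hq⟩⟩ := hv
    obtain ⟨⟨p', rfl⟩, -⟩ := hv'
    obtain ⟨γ, hγ⟩ := exists_isDisorderLine hconn (D.b z 0)
    exact hL.cornerValue_pos_iff_of_quad hE hF hi₀ hi₁ hγ hq p p'
  | Sum.inr (Sum.inl k) =>
    obtain ⟨rfl, -⟩ := hv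
    obtain ⟨rfl, -⟩ := hv'
    exact Iff.rfl
  | Sum.inr (Sum.inr j) =>
    obtain ⟨γ, hγ⟩ := exists_isDisorderLine hconn (D.free j.castSucc)
    have hiff := hL.cornerValue_pos_iff_of_freeFace hE hF hi₀ hi₁ hγ hv.2
    rcases hv.1 with rfl | rfl <;> rcases hv'.1 with rfl | rfl
    exacts [hiff 0 0, hiff 0 1, hiff 1 0, hiff 1 1]

theorem cornerValue_pos_iff_of_isFan (hL : D.IsHorizontalLayer E k₀ k₁)
    (hconn : D.blackGraph.Preconnected) (hE : D.IsWeakSEmbedding E) (hF : D.IsFKFunction E F)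
    {i : Fin (n + 1)} (hfan : D.IsFan (D.wired i)) (hi₀ : k₀ < i) (hi₁ : i < k₁)
    {f g : Face Q n m} {v v' : B} (hv : D.HasCorner f v (D.wired i))
    (hv' : D.HasCorner g v' (D.wired i)) :
    0 < cornerValue E F f v (D.wired i) ↔ 0 < cornerValue E F g v' (D.wired i) := by
  have hchain := hfan f g ⟨v, hv⟩ ⟨v', hv'⟩
  induction hchain generalizing v' with
  | refl => exact hL.cornerValue_pos_iff_of_face hconn hE hF hi₀ hi₁ hv hv'
  | tail _ hshare ih =>
    obtain ⟨x, hx, hx'⟩ := hshare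
    have hiff := ih hx
    rw [hF.sHolomorphic.cornerValue_eq hx hx'] at hiff
    exact hiff.trans (hL.cornerValue_pos_iff_of_face hconn hE hF hi₀ hi₁ hx' hv')

theorem cornerValue_succ_pos_iff (hL : D.IsHorizontalLayer E k₀ k₁)
    (hE : D.IsWeakSEmbedding E) (hF : D.IsFKFunction E F) {k : Fin n} (hk₀ : k₀ ≤ k)
    (hk₁ : k < k₁) {γ : Finset Q} (hγ : D.IsDisorderLine (D.apex k) γ) :
    0 < cornerValue E F (wiredFace k) (D.apex k) (D.wired k.castSucc) ↔
      0 < cornerValue E F (wiredFace k) (D.apex k) (D.wired k.succ) := by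
  have hwhite (q : Fin 2) : (D.wpos E (wiredFace k) q).im < (D.bpos E (wiredFace k) 0).im := by
    fin_cases q
    exacts [hL.im_apex k hk₀ hk₁, hL.im_apex_of_succ hk₀ hk₁]
  refine hE.cornerValue_pos_iff (p := 0) (q := 0) (p' := 0) (q' := 1) rfl rfl rfl rfl
    (hL.im_apex k hk₀ hk₁) (hL.im_apex_of_succ hk₀ hk₁) (mul_pos ?_ ?_)
  · exact hE.im_X_mul_X_of_below hwhite (hL.im_missing k hk₀ hk₁).le
  · exact hF.spinorOf_wiredFace_mul_pos hγ

theorem cornerValue_wiredFace_pos_iff (hL : D.IsHorizontalLayer E k₀ k₁)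
    (hconn : D.blackGraph.Preconnected) (hfan : ∀ i, D.IsFan (D.wired i))
    (hE : D.IsWeakSEmbedding E) (hF : D.IsFKFunction E F) {k k' : Fin n} (hk₀ : k₀ ≤ k)
    (hkk' : k ≤ k') (hk₁ : k' < k₁) :
    0 < cornerValue E F (wiredFace k) (D.apex k) (D.wired k.castSucc) ↔
      0 < cornerValue E F (wiredFace k') (D.apex k') (D.wired k'.castSucc) := by
  obtain ⟨l, hl⟩ := k'
  change (k : ℕ) ≤ l at hkk'
  induction l, hkk' using Nat.le_induction with
  | base => exact Iff.rfl
  | succ l hkl ih =>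
    have hl₀ : k₀ ≤ l := hk₀.trans hkl
    have hl₁ : l < k₁ := l.lt_succ_self.trans hk₁
    obtain ⟨γ, hγ⟩ := exists_isDisorderLine hconn (D.apex ⟨l, l.lt_succ_self.trans hl⟩)
    rw [ih (l.lt_succ_self.trans hl) hl₁, hL.cornerValue_succ_pos_iff hE hF hl₀ hl₁ hγ]
    exact hL.cornerValue_pos_iff_of_isFan hconn hE hF (hfan _) (i := ⟨l + 1, by omega⟩)
      (Nat.lt_succ_of_le hl₀) hk₁ ⟨rfl, Or.inr rfl⟩ ⟨rfl, Or.inl rfl⟩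

theorem cornerValue_succ (hL : D.IsHorizontalLayer E k₀ k₁) (hE : D.IsWeakSEmbedding E)
    (hF : D.IsFKFunction E F) {k : Fin n} (hk₀ : k₀ ≤ k) (hk₁ : k < k₁) {γ : Finset Q}
    (hγ : D.IsDisorderLine (D.apex k) γ) :
    cornerValue E F (wiredFace k) (D.apex k) (D.wired k.succ) =
      cornerValue E F (wiredFace k) (D.apex k) (D.wired k.castSucc) := by
  have hiff := hL.cornerValue_succ_pos_iff hE hF hk₀ hk₁ hγ
  have habs : |cornerValue E F (wiredFace k) (D.apex k) (D.wired k.succ)| =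
      |cornerValue E F (wiredFace k) (D.apex k) (D.wired k.castSucc)| := by
    rw [← hE.abs_spinorOf (f := wiredFace k) (p := 0) (q := 1) rfl rfl,
      ← hE.abs_spinorOf (f := wiredFace k) (p := 0) (q := 0) rfl rfl,
      hF.abs_spinorOf_wiredFace hγ 0, hF.abs_spinorOf_wiredFace hγ 0]
  grind

theorem exists_sign_mul_cornerValue_eq_abs (hL : D.IsHorizontalLayer E k₀ k₁)
    (hconn : D.blackGraph.Preconnected) (hfan : ∀ i, D.IsFan (D.wired i))
    (hE : D.IsWeakSEmbedding E) (hF : D.IsFKFunction E F) :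
    ∃ s : ℝ, (s = 1 ∨ s = -1) ∧ ∀ k : Fin n, k₀ ≤ k → k < k₁ →
      s * cornerValue E F (wiredFace k) (D.apex k) (D.wired k.castSucc) =
        |cornerValue E F (wiredFace k) (D.apex k) (D.wired k.castSucc)| := by
  have hiff (k k' : {k : Fin n // k₀ ≤ k ∧ k < k₁}) :
      0 < cornerValue E F (wiredFace k.1) (D.apex k.1) (D.wired k.1.castSucc) ↔
        0 < cornerValue E F (wiredFace k'.1) (D.apex k'.1) (D.wired k'.1.castSucc) := by
    rcases le_total k.1 k'.1 with hle | hle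
    · exact hL.cornerValue_wiredFace_pos_iff hconn hfan hE hF k.2.1 hle k'.2.2
    · exact (hL.cornerValue_wiredFace_pos_iff hconn hfan hE hF k'.2.1 hle k.2.2).symm
  obtain ⟨s, hs, habs⟩ := exists_sign_mul_eq_abs hiff
  exact ⟨s, hs, fun k hk₀ hk₁ => habs ⟨k, hk₀, hk₁⟩⟩

theorem exists_sign_cornerValue_eq (hL : D.IsHorizontalLayer E k₀ k₁)
    (hconn : D.blackGraph.Preconnected) (hfan : ∀ i, D.IsFan (D.wired i))
    (hE : D.IsWeakSEmbedding E) (hF : D.IsFKFunction E F) :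
    ∃ s : ℝ, (s = 1 ∨ s = -1) ∧ ∀ k : Fin n, k₀ ≤ k → k < k₁ →
      ∀ γ, D.IsDisorderLine (D.apex k) γ → ∀ y, (y = D.wired k.castSucc ∨ y = D.wired k.succ) →
        ∀ i, cornerValue E (fun f => s * F f) (wiredFace k) (D.apex k) y =
          D.fkObservable (D.wired i) γ := by
  obtain ⟨s, hs, habs⟩ := hL.exists_sign_mul_cornerValue_eq_abs hconn hfan hE hF
  refine ⟨s, hs, fun k hk₀ hk₁ γ hγ y hy i => ?_⟩
  have hsucc := hL.cornerValue_succ hE hF hk₀ hk₁ hγ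
  calc cornerValue E (fun f => s * F f) (wiredFace k) (D.apex k) y
      = s * cornerValue E F (wiredFace k) (D.apex k) y := by
        rw [cornerValue, cornerValue, mul_left_comm, re_ofReal_mul]
    _ = s * cornerValue E F (wiredFace k) (D.apex k) (D.wired k.castSucc) := by
        rcases hy with rfl | rfl
        exacts [rfl, by rw [hsucc]]
    _ = |spinorOf E F (wiredFace k) 0 0| := by rw [habs k hk₀ hk₁, hE.abs_spinorOf rfl rfl]
    _ = D.fkObservable (D.wired i) γ := by
        rw [hF.abs_spinorOf_wiredFace hγ i, abs_of_pos (D.fkObservable_wired_pos i γ)]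

end IsHorizontalLayer

end Layer

theorem IsOrigami.increment_eq {D : DomainData B W Q n m} {E : EmbeddingData B W Q n m}
    {𝒬 : B ⊕ W → ℝ} (h𝒬 : D.IsOrigami E 𝒬) (F : Face Q n m → ℂ) (k : Fin n) :
    D.increment E 𝒬 F k = F (wiredFace k) *
        (cornerSqrt E (D.apex k) (D.wired k.castSucc) ^ 2 -
          cornerSqrt E (D.apex k) (D.wired k.succ) ^ 2) +
      I * starRingEnd ℂ (F (wiredFace k)) *
        ((‖cornerSqrt E (D.apex k) (D.wired k.castSucc)‖ : ℂ) ^ 2 -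
          (‖cornerSqrt E (D.apex k) (D.wired k.succ)‖ : ℂ) ^ 2) := by
  have hleft := h𝒬 (wiredFace k) (D.apex k) (D.wired k.castSucc) ⟨rfl, Or.inl rfl⟩
  have hright := h𝒬 (wiredFace k) (D.apex k) (D.wired k.succ) ⟨rfl, Or.inr rfl⟩
  rw [increment, cornerSqrt, cornerSqrt, csqrt_sq, csqrt_sq, sub_sub_sub_cancel_left,
    ← ofReal_pow, ← ofReal_pow, norm_csqrt_sq, norm_csqrt_sq, ← hleft, ← hright,
    ← ofReal_sub, sub_sub_sub_cancel_left]

end DomainData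

theorem mainTheorem9_general {r₀ θ₀ : ℝ} (hr₀ : 1 ≤ r₀) (hθ₀ : 0 < θ₀) {B W Q : Type} [Fintype W]
    [Fintype Q] [DecidableEq Q] {n m : ℕ} {D : DomainData B W Q n m}
    {E : EmbeddingData B W Q n m} {𝒬 : B ⊕ W → ℝ} {F : Face Q n m → ℂ} {k₀ k₁ : ℕ}
    (hconn : D.blackGraph.Preconnected) (hfan : ∀ i, D.IsFan (D.wired i))
    (hE : D.IsWeakSEmbedding E) (h𝒬 : D.IsOrigami E 𝒬) (hF : D.IsFKFunction E F)
    (hL : D.IsHorizontalLayer E k₀ k₁)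
    (hU : ∀ k : Fin n, k₀ ≤ k → k < k₁ → D.UnifHalfQuad E r₀ θ₀ k) :
    ∃ s : ℝ, (s = 1 ∨ s = -1) ∧
      ∀ k : Fin n, k₀ ≤ k → k < k₁ →
        ∀ φ : ℝ, |φ| ≤ Real.pi / 4 + DomainData.aperture r₀ θ₀ / 8 →
          0 ≤ (s * F (wiredFace k) * exp (φ * I)).re ∧
          ∀ y : W, (y = D.wired k.castSucc ∨ y = D.wired k.succ) →
            ∀ γ : Finset Q, D.IsDisorderLine (D.apex k) γ →
              (2 / (r₀ * DomainData.aperture r₀ θ₀ ^ 2))⁻¹ * |D.fkObservable y γ| ≤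
                  (exp (φ * I) * D.increment E 𝒬 (fun f => s * F f) k).re ∧
                (exp (φ * I) * D.increment E 𝒬 (fun f => s * F f) k).re ≤
                  2 / (r₀ * DomainData.aperture r₀ θ₀ ^ 2) * |D.fkObservable y γ| := by
  obtain ⟨s, hs, hval⟩ := hL.exists_sign_cornerValue_eq hconn hfan hE hF
  refine ⟨s, hs, fun k hk₀ hk₁ φ hφ => ?_⟩
  have hhalf := (hU k hk₀ hk₁).isHalfQuad hr₀ hθ₀ (hL.re_lt k hk₀ hk₁) (hL.im_eq k hk₀ hk₁)
    (hL.im_apex k hk₀ hk₁)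
  refine ⟨?_, fun y hy γ hγ => ?_⟩
  · obtain ⟨γ, hγ⟩ := DomainData.exists_isDisorderLine hconn (D.apex k)
    exact hhalf.re_mul_exp_nonneg hφ (D.fkObservable_wired_pos 0 γ).le
      (hval k hk₀ hk₁ γ hγ _ (Or.inl rfl) 0) (hval k hk₀ hk₁ γ hγ _ (Or.inr rfl) 0)
  · obtain ⟨i, rfl⟩ : ∃ i, y = D.wired i := hy.elim (⟨_, ·⟩) (⟨_, ·⟩)
    have hpos := D.fkObservable_wired_pos i γ
    obtain ⟨hlower, hupper⟩ := hhalf.re_exp_mul_increment_mem_Icc hφ hpos.le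
      (hval k hk₀ hk₁ γ hγ _ (Or.inl rfl) i) (hval k hk₀ hk₁ γ hγ _ (Or.inr rfl) i)
    rw [h𝒬.increment_eq, abs_of_pos hpos, inv_div]
    exact ⟨hlower, hupper.trans (mul_le_mul_of_nonneg_right
      (DomainData.four_mul_le_two_div_aperture hr₀ hθ₀) hpos.le)⟩

theorem mainTheorem9 (r₀ θ₀ : ℝ) (hr₀ : 1 ≤ r₀) (hθ₀ : 0 < θ₀) :
    ∃ φ₀ : ℝ, 0 < φ₀ ∧ ∃ C : ℝ, 0 < C ∧
      ∀ (B W Q : Type) [Fintype B] [Fintype W] [Fintype Q] [DecidableEq Q] (n m : ℕ)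
        (D : DomainData B W Q n m) (E : EmbeddingData B W Q n m)
        (𝒬 : B ⊕ W → ℝ) (F : Face Q n m → ℂ) (k₀ k₁ : ℕ),
        D.IsDobrushinDomain → D.IsSEmbedding E → D.IsOrigami E 𝒬 →
        D.IsFKFunction E F → D.IsHorizontalLayer E k₀ k₁ →
        (∀ k : Fin n, k₀ ≤ k → k < k₁ → D.UnifHalfQuad E r₀ θ₀ k) →
        ∃ s : ℝ, (s = 1 ∨ s = -1) ∧
          ∀ k : Fin n, k₀ ≤ k → k < k₁ → ∀ φ : ℝ, |φ| ≤ Real.pi / 4 + φ₀ →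
            0 ≤ (s * F (wiredFace k) * Complex.exp (φ * Complex.I)).re ∧
            ∀ y : W, (y = D.wired k.castSucc ∨ y = D.wired k.succ) →
              ∀ γ : Finset Q, D.IsDisorderLine (D.apex k) γ →
                C⁻¹ * |D.fkObservable y γ| ≤
                    (Complex.exp (φ * Complex.I) *
                      D.increment E 𝒬 (fun f => s * F f) k).re ∧
                  (Complex.exp (φ * Complex.I) *
                      D.increment E 𝒬 (fun f => s * F f) k).re ≤
                    C * |D.fkObservable y γ| :=
  have hε := DomainData.aperture_pos (zero_lt_one.trans_le hr₀) hθ₀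
  ⟨_, by positivity, _, by positivity, fun _ _ _ _ _ _ _ _ _ _ _ _ _ _ _ hD hE h𝒬 hF hL hU =>
    mainTheorem9_general hr₀ hθ₀ hD.connected.preconnected (fun _ => hD.white_fan _)
      hE.isWeakSEmbedding h𝒬 hF hL hU⟩
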